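/- A topological group $G$ is called pro-oligomorphic if it is Polish, non-archimedean (the open subgroups form a basis of neighbourhoods of the identity) and Roelcke precompact (for every neighbourhood $U$ of the identity there is a finite set $F\subseteq G$ with $G=UFU$). Let $C(G)$ be the space of bounded continuous functions $G\to\mathbb{C}$ with the uniform norm, and let the Fourier--Stieltjes algebra $B(G)\subseteq C(G)$ be the set of all matrix coefficients $g\mapsto\langle v,\pi(g)w\rangle$, where $\pi\colon G\to U(\mathcal{H})$ is a unitary representation on a complex Hilbert space $\mathcal{H}$, continuous for the strong operator topology, and $v,w\in\mathcal{H}$. Let $G$ be pro-oligomorphic and infinite. Then $B(G)$ is not closed in $C(G)$ for the uniform norm. -/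

import Mathlib

open scoped Pointwise Topology BoundedContinuousFunction

universe u v

/-- A topological group `G` is Roelcke precompact if for every neighbourhood `U` of the identity
there is a finite set `F ⊆ G` such that `G = U F U`. -/
def IsRoelckePrecompact (G : Type u) [Group G] [TopologicalSpace G] : Prop :=
  ∀ U ∈ 𝓝 (1 : G), ∃ F : Set G, F.Finite ∧ U * F * U = Set.univ

/-- A pro-oligomorphic group: a topological group which is non-archimedean (it has a basis at the
identity consisting of open subgroups), Polish, and Roelcke precompact. -/
structure IsProOligomorphic (G : Type u) [Group G] [TopologicalSpace G] : Prop where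
  nonarchimedean : NonarchimedeanGroup G
  polish : PolishSpace G
  roelckePrecompact : IsRoelckePrecompact G

/-- A continuous unitary representation of `G` on the complex inner product space `H`
(a Hilbert space wherever it is used): a homomorphism from `G` to the unitary group of `H`
that is continuous for the strong operator topology, the topology of pointwise convergence. -/
structure ContinuousUnitaryRep (G : Type u) [Group G] [TopologicalSpace G]
    (H : Type v) [NormedAddCommGroup H] [InnerProductSpace ℂ H] where
  toHom : G →* (H ≃ₗᵢ[ℂ] H)
  continuous_apply : ∀ w : H, Continuous fun g : G => toHom g w

/-- The matrix coefficient `g ↦ ⟨v, π(g) w⟩` of a continuous unitary representation, as an element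
of the space `G →ᵇ ℂ` of bounded continuous functions. -/
noncomputable def matrixCoefficient {G : Type u} [Group G] [TopologicalSpace G]
    {H : Type v} [NormedAddCommGroup H] [InnerProductSpace ℂ H]
    (π : ContinuousUnitaryRep G H) (v w : H) : G →ᵇ ℂ :=
  BoundedContinuousFunction.ofNormedAddCommGroup
    (fun g => inner ℂ v (π.toHom g w))
    (continuous_const.inner (π.continuous_apply w))
    (‖v‖ * ‖w‖)
    (fun g => by
      simpa using norm_inner_le_norm (𝕜 := ℂ) v (π.toHom g w))

/-- The Fourier–Stieltjes algebra `B(G)`: the family of all matrix coefficients of continuous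
unitary representations of `G` on complex Hilbert spaces, inside the space `G →ᵇ ℂ` of bounded
continuous functions with the uniform norm. The universe of the Hilbert spaces is that of `G`:
a matrix coefficient is always one of the cyclic representation generated by `w`, and this is
isomorphic to a Hilbert space completion of a quotient of the finitely supported functions on
`G`. -/
def fourierStieltjes (G : Type u) [Group G] [TopologicalSpace G] : Set (G →ᵇ ℂ) :=
  {f | ∃ (H : Type u) (_ : NormedAddCommGroup H) (_ : InnerProductSpace ℂ H)
      (_ : CompleteSpace H) (π : ContinuousUnitaryRep G H) (v w : H),
      f = matrixCoefficient π v w}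

/-!
The proof compares two norms on finitely supported functions `c` on `G`: the `ℓ¹` norm, and the
largest norm of `∑ s, c s • π s` over all continuous unitary representations `π`.

* A matrix coefficient `f = ⟨v, π(·) w⟩` satisfies `|∑ s, c s * f s| ≤ ‖v‖ ‖w‖ ‖∑ s, c s • π s‖`. If
  `B(G)` were closed, it would be a Banach space for the uniform norm, and the uniform boundedness
  principle would bound all the functionals `f ↦ ∑ s, c s * f s` for which `‖∑ s, c s • π s‖ ≤ 1`
  in every `π` by one constant multiple of the uniform norm.
* The Rudin–Shapiro recursion `(P, Q) ↦ (P + g Q, P - g Q)` works in any infinite group: it yields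
  unimodular `c` on sets of `2 ^ k` elements with `‖∑ s, c s • π s‖ ^ 2 ≤ 2 ^ (k + 1)` for every
  unitary `π`, by the parallelogram law (`exists_rudinShapiro`).
* If `V` is an open subgroup so small that the points of a finite set `S` lie in distinct cosets of
  `V`, then prescribed values of modulus at most one on `S` are attained by a coefficient of the
  permutation representation on `ℓ²(G ⧸ V)` that is constant on these cosets, vanishes elsewhere,
  and so has uniform norm at most one (`exists_mem_fourierStieltjes_eq_on_finset`).

Testing the functional of a Rudin–Shapiro `c` on the function with values `conj (c s)` gives
`2 ^ k ≤ C * √(2 ^ (k + 1))` for all `k`, which is absurd.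
-/

/-! ### The Fourier–Stieltjes algebra as a linear subspace -/

@[simp]
theorem matrixCoefficient_apply {G : Type u} [Group G] [TopologicalSpace G]
    {H : Type v} [NormedAddCommGroup H] [InnerProductSpace ℂ H]
    (π : ContinuousUnitaryRep G H) (v w : H) (g : G) :
    matrixCoefficient π v w g = inner ℂ v (π.toHom g w) := rfl

/-- The orthogonal direct sum of two continuous unitary representations. -/
noncomputable def ContinuousUnitaryRep.prod {G : Type u} [Group G] [TopologicalSpace G]
    {H : Type v} [NormedAddCommGroup H] [InnerProductSpace ℂ H]
    {K : Type v} [NormedAddCommGroup K] [InnerProductSpace ℂ K]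
    (π : ContinuousUnitaryRep G H) (ρ : ContinuousUnitaryRep G K) :
    ContinuousUnitaryRep G (WithLp 2 (H × K)) where
  toHom :=
    { toFun := fun g => LinearIsometryEquiv.withLpProdCongr 2 (π.toHom g) (ρ.toHom g)
      map_one' := by
        ext x
        simp only [map_one]
        rfl
      map_mul' := fun g h => by
        ext x
        simp only [map_mul]
        rfl }
  continuous_apply := fun w =>
    (WithLp.prod_continuous_toLp 2 H K).comp
      ((π.continuous_apply w.fst).prodMk (ρ.continuous_apply w.snd))

theorem add_mem_fourierStieltjes {G : Type u} [Group G] [TopologicalSpace G] {f₁ f₂ : G →ᵇ ℂ}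
    (h₁ : f₁ ∈ fourierStieltjes G) (h₂ : f₂ ∈ fourierStieltjes G) :
    f₁ + f₂ ∈ fourierStieltjes G := by
  obtain ⟨H, _, _, _, π, v, w, rfl⟩ := h₁
  obtain ⟨K, _, _, _, ρ, v', w', rfl⟩ := h₂
  refine ⟨WithLp 2 (H × K), inferInstance, inferInstance, inferInstance, π.prod ρ,
    WithLp.toLp 2 (v, v'), WithLp.toLp 2 (w, w'), ?_⟩
  ext g
  rfl

theorem smul_mem_fourierStieltjes {G : Type u} [Group G] [TopologicalSpace G] (c : ℂ)
    {f : G →ᵇ ℂ} (h : f ∈ fourierStieltjes G) : c • f ∈ fourierStieltjes G := by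
  obtain ⟨H, _, _, _, π, v, w, rfl⟩ := h
  refine ⟨H, inferInstance, inferInstance, inferInstance, π, v, c • w, ?_⟩
  ext g
  simp

/-! ### Permutation representations -/

/-- The unitary operator on `ℓ²(X)` permuting the coordinates: it sends the basis vector at `x` to
the basis vector at `σ x`. -/
noncomputable def lpPermute {X : Type u} (σ : Equiv.Perm X) :
    lp (fun _ : X => ℂ) 2 ≃ₗᵢ[ℂ] lp (fun _ : X => ℂ) 2 where
  toFun f := ⟨fun x => f (σ.symm x), by
    refine memℓp_gen ?_
    exact (σ.symm.summable_iff (f := fun x => ‖f x‖ ^ (2 : ENNReal).toReal)).2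
      ((lp.memℓp f).summable (by norm_num))⟩
  invFun f := ⟨fun x => f (σ x), by
    refine memℓp_gen ?_
    exact (σ.summable_iff (f := fun x => ‖f x‖ ^ (2 : ENNReal).toReal)).2
      ((lp.memℓp f).summable (by norm_num))⟩
  left_inv f := by
    ext x
    simp
  right_inv f := by
    ext x
    simp
  map_add' f g := rfl
  map_smul' c f := rfl
  norm_map' f := by
    have h : (0 : ℝ) < (2 : ENNReal).toReal := by norm_num
    rw [lp.norm_eq_tsum_rpow h, lp.norm_eq_tsum_rpow h]
    congr 1
    exact σ.symm.tsum_eq (fun x => ‖f x‖ ^ (2 : ENNReal).toReal)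

theorem lpPermute_apply {X : Type u} (σ : Equiv.Perm X) (f : lp (fun _ : X => ℂ) 2) (x : X) :
    lpPermute σ f x = f (σ.symm x) := rfl

theorem lpPermute_single {X : Type u} [DecidableEq X] (σ : Equiv.Perm X) (x : X) (a : ℂ) :
    lpPermute σ (lp.single 2 x a) = lp.single 2 (σ x) a := by
  ext y
  rw [lpPermute_apply, lp.single_apply, lp.single_apply, Pi.single_apply, Pi.single_apply]
  simp [Equiv.symm_apply_eq]

/-- The representation on `ℓ²(X)` of a group acting on the set `X` with open stabilizers. -/
noncomputable def permutationRep {G : Type u} [Group G] [TopologicalSpace G]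
    [IsTopologicalGroup G] (X : Type u) [MulAction G X]
    (hX : ∀ x : X, IsOpen (MulAction.stabilizer G x : Set G)) :
    ContinuousUnitaryRep G (lp (fun _ : X => ℂ) 2) where
  toHom :=
    { toFun := fun g => lpPermute (MulAction.toPerm g)
      map_one' := by
        ext f x
        simp [lpPermute_apply]
      map_mul' := fun g h => by
        ext f x
        simp [lpPermute_apply, mul_smul] }
  continuous_apply := fun w => by
    classical
    -- The orbit map of a basis vector is locally constant.
    have hsingle : ∀ (x : X) (a : ℂ), Continuous fun g : G =>
        lpPermute (MulAction.toPerm g) (lp.single (E := fun _ : X => ℂ) 2 x a) := by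
      intro x a
      refine IsLocallyConstant.continuous ((IsLocallyConstant.iff_exists_open _).2 fun g => ?_)
      refine ⟨(fun h => g⁻¹ * h) ⁻¹' (MulAction.stabilizer G x : Set G),
        (hX x).preimage (continuous_const_mul _), by simp, fun h hh => ?_⟩
      have hx : h • x = g • x := by
        have : (g⁻¹ * h) • x = x := hh
        rwa [mul_smul, inv_smul_eq_iff] at this
      simp only [lpPermute_single, MulAction.toPerm_apply, hx]
    -- Finite combinations of basis vectors approximate `w`, uniformly over the group since every
    -- operator is isometric.
    refine continuous_of_uniform_approx_of_continuous fun u hu => ?_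
    obtain ⟨ε, hε, hεu⟩ := Metric.mem_uniformity_dist.1 hu
    obtain ⟨s, hs⟩ := ((Metric.tendsto_nhds.1
      (lp.hasSum_single (p := 2) (by norm_num) w)) ε hε).exists
    refine ⟨fun g => lpPermute (MulAction.toPerm g) (∑ x ∈ s, lp.single 2 x (w x)), ?_,
      fun g => hεu ?_⟩
    · simp only [map_sum]
      exact continuous_finsetSum _ fun x _ => hsingle x _
    · rw [dist_comm] at hs
      exact ((lpPermute _).dist_map _ _).trans_lt hs

theorem permutationRep_single {G : Type u} [Group G] [TopologicalSpace G]
    [IsTopologicalGroup G] {X : Type u} [DecidableEq X] [MulAction G X]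
    (hX : ∀ x : X, IsOpen (MulAction.stabilizer G x : Set G)) (g : G) (x : X) (a : ℂ) :
    (permutationRep X hX).toHom g (lp.single 2 x a) = lp.single 2 (g • x) a :=
  lpPermute_single _ _ _

/-! ### Interpolation by matrix coefficients -/

/-- Any function with finite support on `G ⧸ V`, with `V` open, is a matrix coefficient. -/
theorem exists_mem_fourierStieltjes_of_openSubgroup {G : Type u} [Group G] [TopologicalSpace G]
    [IsTopologicalGroup G] (V : OpenSubgroup G) (S : Finset (G ⧸ (V : Subgroup G)))
    (p : G ⧸ (V : Subgroup G) → ℂ) [DecidableEq (G ⧸ (V : Subgroup G))] :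
    ∃ f ∈ fourierStieltjes G, ∀ g : G, f g = if (g : G ⧸ (V : Subgroup G)) ∈ S then p g else 0 := by
  have hX : ∀ x : G ⧸ (V : Subgroup G), IsOpen (MulAction.stabilizer G x : Set G) := by
    intro x
    induction x using QuotientGroup.induction_on with
    | H a =>
      have : (MulAction.stabilizer G (a : G ⧸ (V : Subgroup G)) : Set G) =
          (fun g => a⁻¹ * g * a) ⁻¹' (V : Set G) := by
        ext g
        have h : g • (a : G ⧸ (V : Subgroup G)) = ((g * a : G) : G ⧸ (V : Subgroup G)) := rfl
        rw [SetLike.mem_coe, MulAction.mem_stabilizer_iff, h, eq_comm, QuotientGroup.eq]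
        simp [mul_assoc]
      rw [this]
      exact V.isOpen.preimage (by fun_prop)
  refine ⟨_, ⟨_, inferInstance, inferInstance, inferInstance, permutationRep _ hX,
    ∑ x ∈ S, lp.single 2 x (starRingEnd ℂ (p x)),
    lp.single 2 ((1 : G) : G ⧸ (V : Subgroup G)) 1, rfl⟩, fun g => ?_⟩
  have h : g • ((1 : G) : G ⧸ (V : Subgroup G)) = (g : G ⧸ (V : Subgroup G)) := by
    change ((g * 1 : G) : G ⧸ (V : Subgroup G)) = _
    rw [mul_one]
  rw [matrixCoefficient_apply, permutationRep_single, h, sum_inner]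
  simp only [lp.inner_single_left, lp.single_apply, Pi.single_apply, RCLike.inner_apply,
    RingHomCompTriple.comp_apply, RingHom.id_apply, ite_mul, one_mul, zero_mul,
    Finset.sum_ite_eq']

/-- Finitely many points of a Hausdorff nonarchimedean group lie in distinct cosets of some open
subgroup. -/
theorem exists_openSubgroup_injOn_mk {G : Type u} [Group G] [TopologicalSpace G]
    [NonarchimedeanGroup G] [T1Space G] (S : Finset G) :
    ∃ V : OpenSubgroup G, Set.InjOn (fun g : G => (g : G ⧸ (V : Subgroup G))) S := by
  classical
  obtain ⟨V, hV⟩ := NonarchimedeanGroup.is_nonarchimedean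
    (((S ×ˢ S).image fun x : G × G => x.1⁻¹ * x.2).erase 1 : Set G)ᶜ
    ((Finset.finite_toSet _).isClosed.isOpen_compl.mem_nhds (by simp))
  refine ⟨V, fun a ha b hb hab => ?_⟩
  have h : a⁻¹ * b ∈ V := QuotientGroup.eq.1 hab
  by_contra hne
  refine hV h ?_
  rw [Finset.mem_coe, Finset.mem_erase]
  exact ⟨fun h1 => hne (inv_mul_eq_one.1 h1),
    Finset.mem_image.2 ⟨(a, b), Finset.mk_mem_product ha hb, rfl⟩⟩

theorem exists_mem_fourierStieltjes_eq_on_finset {G : Type u} [Group G] [TopologicalSpace G]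
    [NonarchimedeanGroup G] [T1Space G] (S : Finset G) (p : G → ℂ) (hp : ∀ s ∈ S, ‖p s‖ ≤ 1) :
    ∃ f ∈ fourierStieltjes G, ‖f‖ ≤ 1 ∧ ∀ s ∈ S, f s = p s := by
  classical
  obtain ⟨V, hV⟩ := exists_openSubgroup_injOn_mk S
  let q : G → G ⧸ (V : Subgroup G) := fun g => (g : G ⧸ (V : Subgroup G))
  obtain ⟨f, hf, hfe⟩ := exists_mem_fourierStieltjes_of_openSubgroup V (S.image q)
    (fun x => p (Function.invFunOn q S x))
  refine ⟨f, hf, (BoundedContinuousFunction.norm_le zero_le_one).2 fun g => ?_, fun s hs => ?_⟩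
  · rw [hfe]
    split_ifs with h
    · obtain ⟨s, hs, hsg⟩ := Finset.mem_image.1 h
      exact hp _ (Function.invFunOn_mem (s := (S : Set G)) (f := q) ⟨s, hs, hsg⟩)
    · simp
  · rw [hfe, if_pos (Finset.mem_image_of_mem q hs)]
    exact congrArg p (hV.leftInvOn_invFunOn hs)

/-! ### Rudin–Shapiro elements of the group algebra -/

/-- A Rudin–Shapiro pair: unimodular functions `p` and `q` on a set of `2 ^ k` elements of an
infinite group, whose images in any unitary representation have small norm. -/
theorem exists_rudinShapiro (G : Type u) [Group G] [Infinite G] (k : ℕ) :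
    ∃ (S : Finset G) (p q : G → ℂ), S.card = 2 ^ k ∧ (∀ s ∈ S, ‖p s‖ = 1) ∧ (∀ s ∈ S, ‖q s‖ = 1) ∧
      ∀ (H : Type v) [NormedAddCommGroup H] [InnerProductSpace ℂ H]
        (π : G →* (H ≃ₗᵢ[ℂ] H)) (w : H),
        ‖∑ s ∈ S, p s • π s w‖ ^ 2 + ‖∑ s ∈ S, q s • π s w‖ ^ 2 = 2 ^ (k + 1) * ‖w‖ ^ 2 := by
  classical
  induction k with
  | zero =>
    refine ⟨{1}, fun _ => 1, fun _ => 1, by simp, by simp, by simp, fun H _ _ π w => ?_⟩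
    simp
    ring
  | succ k ih =>
    obtain ⟨S, p, q, hcard, hp, hq, hS⟩ := ih
    -- A translate of `S` disjoint from `S`.
    obtain ⟨g, hg⟩ := Infinite.exists_notMem_finset
      ((S ×ˢ S).image fun x : G × G => x.1 * x.2⁻¹)
    have hgS : ∀ s ∈ S, g * s ∉ S := fun s hs h => hg
      (Finset.mem_image.2 ⟨(g * s, s), Finset.mk_mem_product h hs, by simp⟩)
    have hinj : Function.Injective fun s : G => g * s := mul_right_injective g
    have hdisj : Disjoint S (S.image fun s => g * s) := by
      rw [Finset.disjoint_left]
      intro a ha hga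
      obtain ⟨s, hs, rfl⟩ := Finset.mem_image.1 hga
      exact hgS s hs ha
    have hsum : ∀ (H : Type v) [NormedAddCommGroup H] [InnerProductSpace ℂ H]
        (π : G →* (H ≃ₗᵢ[ℂ] H)) (w : H) (r : G → ℂ),
        ∑ s ∈ S ∪ S.image (fun s => g * s), (if s ∈ S then p s else r (g⁻¹ * s)) • π s w =
          ∑ s ∈ S, p s • π s w + π g (∑ s ∈ S, r s • π s w) := by
      intro H _ _ π w r
      rw [Finset.sum_union hdisj, Finset.sum_image hinj.injOn, map_sum]
      congr 1
      · exact Finset.sum_congr rfl fun s hs => by rw [if_pos hs]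
      · exact Finset.sum_congr rfl fun s hs => by
          simp [if_neg (hgS s hs), map_mul, map_smul]
    have hnorm : ∀ r : G → ℂ, (∀ s ∈ S, ‖r s‖ = 1) →
        ∀ s ∈ S ∪ S.image (fun s => g * s), ‖if s ∈ S then p s else r (g⁻¹ * s)‖ = 1 := by
      intro r hr s hs
      split_ifs with h
      · exact hp s h
      · obtain ⟨t, ht, rfl⟩ := Finset.mem_image.1 ((Finset.mem_union.1 hs).resolve_left h)
        simpa using hr t ht
    refine ⟨S ∪ S.image (fun s => g * s), fun s => if s ∈ S then p s else q (g⁻¹ * s),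
      fun s => if s ∈ S then p s else -q (g⁻¹ * s), ?_, hnorm q hq,
      hnorm (fun s => -q s) (by simpa using hq), fun H _ _ π w => ?_⟩
    · rw [Finset.card_union_of_disjoint hdisj, Finset.card_image_of_injective _ hinj, hcard]
      ring
    · rw [hsum H π w q, hsum H π w (fun s => -q s)]
      simp only [neg_smul, Finset.sum_neg_distrib, map_neg, ← sub_eq_add_neg]
      have := parallelogram_law_with_norm ℂ (∑ s ∈ S, p s • π s w) (π g (∑ s ∈ S, q s • π s w))
      rw [LinearIsometryEquiv.norm_map] at this
      have h := hS H π w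
      rw [pow_succ 2 (k + 1)]
      linarith

/-! ### Failure of closedness -/

/-- If the Fourier–Stieltjes algebra is closed, then functionals given by finite sums which are
uniformly bounded in all unitary representations are uniformly bounded for the uniform norm. -/
theorem exists_bound_of_isClosed_fourierStieltjes {G : Type u} [Group G] [TopologicalSpace G]
    (h0 : (0 : G →ᵇ ℂ) ∈ fourierStieltjes G) (hB : IsClosed (fourierStieltjes G))
    {ι : Type*} (S : ι → Finset G) (c : ι → G → ℂ)
    (hc : ∀ (i : ι) (H : Type u) [NormedAddCommGroup H] [InnerProductSpace ℂ H]
      (π : G →* (H ≃ₗᵢ[ℂ] H)) (w : H), ‖∑ s ∈ S i, c i s • π s w‖ ≤ ‖w‖) :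
    ∃ C : ℝ, ∀ i, ∀ f ∈ fourierStieltjes G, ‖∑ s ∈ S i, c i s * f s‖ ≤ C * ‖f‖ := by
  let E : Submodule ℂ (G →ᵇ ℂ) :=
    { carrier := fourierStieltjes G
      add_mem' := add_mem_fourierStieltjes
      zero_mem' := h0
      smul_mem' := fun c _ h => smul_mem_fourierStieltjes c h }
  have : CompleteSpace E := IsClosed.completeSpace_coe (s := fourierStieltjes G) (hs := hB)
  let φ : ι → E →L[ℂ] ℂ := fun i =>
    (∑ s ∈ S i, c i s • BoundedContinuousFunction.evalCLM ℂ s).comp E.subtypeL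
  have hφ : ∀ i (f : E), φ i f = ∑ s ∈ S i, c i s * (f : G →ᵇ ℂ) s := by
    intro i f
    simp [φ]
  obtain ⟨C, hC⟩ := banach_steinhaus (g := φ) (by
    rintro ⟨f, H, _, _, _, π, v, w, rfl⟩
    refine ⟨‖v‖ * ‖w‖, fun i => ?_⟩
    have : ∑ s ∈ S i, c i s * matrixCoefficient π v w s =
        inner ℂ v (∑ s ∈ S i, c i s • π.toHom s w) := by
      simp
    rw [hφ, this]
    exact (norm_inner_le_norm _ _).trans
      (mul_le_mul_of_nonneg_left (hc i H π.toHom w) (norm_nonneg v)))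
  refine ⟨C, fun i f hf => ?_⟩
  rw [← hφ i ⟨f, hf⟩]
  exact (φ i).le_of_opNorm_le (hC i) _

theorem not_isClosed_fourierStieltjes {G : Type u} [Group G] [TopologicalSpace G]
    [NonarchimedeanGroup G] [T1Space G] [Infinite G] : ¬ IsClosed (fourierStieltjes G) := by
  intro hB
  obtain ⟨f₀, hf₀, -⟩ := exists_mem_fourierStieltjes_eq_on_finset (∅ : Finset G) 0 (by simp)
  have h0 : (0 : G →ᵇ ℂ) ∈ fourierStieltjes G := by
    simpa using smul_mem_fourierStieltjes 0 hf₀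
  -- Odd exponents make the norm bound `√(2 ^ (2 * k + 2)) = 2 ^ (k + 1)` a power of two.
  choose S p q hcard hp _ hS using fun k : ℕ => exists_rudinShapiro.{_, u} G (2 * k + 1)
  obtain ⟨C, hC⟩ := exists_bound_of_isClosed_fourierStieltjes h0 hB S
    (fun k s => ((2 : ℂ) ^ (k + 1))⁻¹ * p k s) (by
      intro k H _ _ π w
      simp only [mul_smul, ← Finset.smul_sum]
      rw [norm_smul, norm_inv, norm_pow, Complex.norm_ofNat, inv_mul_le_iff₀ (by positivity)]
      refine le_of_sq_le_sq ?_ (by positivity)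
      have h := hS k H π w
      calc ‖∑ s ∈ S k, p k s • π s w‖ ^ 2 ≤ 2 ^ (2 * k + 1 + 1) * ‖w‖ ^ 2 := by
            rw [← h]
            exact le_add_of_nonneg_right (sq_nonneg _)
        _ = (2 ^ (k + 1) * ‖w‖) ^ 2 := by ring)
  obtain ⟨k, hk⟩ := pow_unbounded_of_one_lt (max C 0) one_lt_two
  obtain ⟨f, hf, hf1, hfp⟩ := exists_mem_fourierStieltjes_eq_on_finset (S k)
    (fun s => starRingEnd ℂ (p k s)) (fun s hs => by simp [hp k s hs])
  have hsum : ∑ s ∈ S k, ((2 : ℂ) ^ (k + 1))⁻¹ * p k s * f s = 2 ^ k := by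
    have : ∀ s ∈ S k, ((2 : ℂ) ^ (k + 1))⁻¹ * p k s * f s = ((2 : ℂ) ^ (k + 1))⁻¹ := by
      intro s hs
      rw [hfp s hs, mul_assoc, Complex.mul_conj', hp k s hs]
      simp
    rw [Finset.sum_congr rfl this, Finset.sum_const, hcard, nsmul_eq_mul, Nat.cast_pow,
      Nat.cast_ofNat, mul_inv_eq_iff_eq_mul₀ (pow_ne_zero _ two_ne_zero)]
    ring
  have h := hC k f hf
  rw [hsum, norm_pow, Complex.norm_ofNat] at h
  have h2 : C * ‖f‖ ≤ max C 0 := by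
    calc C * ‖f‖ ≤ max C 0 * ‖f‖ := mul_le_mul_of_nonneg_right (le_max_left _ _) (norm_nonneg _)
      _ ≤ max C 0 * 1 := mul_le_mul_of_nonneg_left hf1 (le_max_right _ _)
      _ = max C 0 := mul_one _
  linarith

theorem mainTheorem10 (G : Type*) [Group G] [TopologicalSpace G]
    (hG : IsProOligomorphic G) (hinf : Infinite G) :
    ¬ IsClosed (fourierStieltjes G) := by
  have := hG.nonarchimedean
  have := hG.polish
  exact not_isClosed_fourierStieltjes
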